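/- Let $M$ be a finite set of items, $\mathcal C\subseteq 2^M$ a downward closed set system, and for every $T\subseteq M$ let $\mathcal H_T$ be a finitely supported probability distribution on $[0,\infty)$, where $\mathcal H_T$ is the point mass at $0$ if $T=\emptyset$ or $T\notin\mathcal C$. Draw $w(T)\sim\mathcal H_T$ independently for all $T\subseteq M$. The buyer's valuation is $$v(S)=\max_{T\subseteq S,\ T\in\mathcal C}\ \sum_{U\subseteq T}w(U),\qquad S\subseteq M .$$ Suppose that this distribution has complementarity $d$: for every $w$ in the support and every item $i$, $|\{S\ni i: w(S)>0\}|\le d$. - $\mathrm{BREV}=\sup_{p\ge 0}\,p\cdot\Pr[v(M)\ge p]$. - $\mathrm{SREV}^*=\sup_{p\in[0,\infty)^M}\mathbb E\big[\sum_{i\in M}P_i(p,v)\,p_i\big]$, where $P_i(p,v)=1$ if every set $S\subseteq M$ that maximizes the utility $v(S)-\sum_{j\in S}p_j$ contains $i$, and $P_i(p,v)=0$ otherwise. - For a finitely supported distribution of $X\ge 0$, let $\bar R$ be the least concave majorant on $[0,1]$ of the revenue curve, i.e. of the points $(\Pr[X\ge p],\,p\Pr[X\ge p])$, $p\ge 0$.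 Myerson's ironed virtual value at a point $x$ of the support is $\bar\varphi(x)=\big(\bar R(\Pr[X\ge x])-\bar R(\Pr[X>x])\big)/\Pr[X=x]$. Write $\bar\varphi_T$ for that of $\mathcal H_T$. - For non-empty $A\subseteq M$, $R_A$ is the event that $A$ maximizes $w(T)$ over non-empty $T\subseteq M$, ties being broken by a fixed linear order on the subsets (for instance the lexicographic one), and $$\mathrm{SINGLE}=\mathbb E\Big[\sum_{\emptyset\ne S\subseteq M}\max\{0,\bar\varphi_S(w(S))\}\cdot\mathbf 1[R_S]\Big].$$ Then $$\mathrm{SINGLE}\ \le\ 4d\cdot\mathrm{SREV}^*+4\cdot\mathrm{BREV}.$$ -/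

import Mathlib

open MeasureTheory Set
open scoped NNReal

/-! A single buyer with item set `ι`. A hypergraph representation is a function
`w : Finset ι → ℝ≥0`; the substitutes constraints are a set system `C` on `ι`; the weights `w T`
are drawn independently from the distributions `H T`. -/

noncomputable section

namespace Complements

variable {ι : Type*} [Fintype ι] [DecidableEq ι]

/-- The valuation `v(S) = max_{T ⊆ S, T ∈ C} ∑_{U ⊆ T} w(U)`. (The summands are non-negative, so
`Finset.sup`, whose value on the empty family is `0`, is this maximum.) -/
def value (C : Finset (Finset ι)) (w : Finset ι → ℝ≥0) (S : Finset ι) : ℝ≥0 :=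
  (C.filter (fun T => T ⊆ S)).sup (fun T => ∑ U ∈ T.powerset, w U)

/-- The joint law of the weights: the product of the marginals `H T`. -/
def weightLaw (H : Finset ι → PMF ℝ≥0) : Measure (Finset ι → ℝ≥0) :=
  Measure.pi (fun T => (H T).toMeasure)

/-- The distribution has complementarity `d`: for every `w` in the support, every item lies in at
most `d` hyperedges of positive weight. -/
def HasComplementarity (H : Finset ι → PMF ℝ≥0) (d : ℕ) : Prop :=
  ∀ w : Finset ι → ℝ≥0, (∀ T, w T ∈ (H T).support) →
    ∀ i : ι, (Finset.univ.filter (fun S : Finset ι => i ∈ S ∧ 0 < w S)).card ≤ d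

/-! ### Bundling together and selling separately -/

/-- `BREV`: the best revenue `p · Pr[v(ι) ≥ p]` of a posted price on the grand bundle. -/
def brev (C : Finset (Finset ι)) (H : Finset ι → PMF ℝ≥0) : ℝ :=
  ⨆ p : ℝ≥0, (p : ℝ) * (weightLaw H).real {w | p ≤ value C w Finset.univ}

/-- Utility of the bundle `S` at item prices `p`. -/
def utility (C : Finset (Finset ι)) (w : Finset ι → ℝ≥0) (p : ι → ℝ≥0) (S : Finset ι) : ℝ :=
  (value C w S : ℝ) - ∑ j ∈ S, (p j : ℝ)

/-- Item `i` counts as sold at prices `p`: every utility-maximizing bundle contains `i`. -/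
def Sold (C : Finset (Finset ι)) (w : Finset ι → ℝ≥0) (p : ι → ℝ≥0) (i : ι) : Prop :=
  ∀ S : Finset ι, (∀ S' : Finset ι, utility C w p S' ≤ utility C w p S) → i ∈ S

open Classical in
/-- `SREV*`: the optimal revenue of an item pricing, where an item only counts as sold if every
bundle that the buyer may choose to purchase contains it. -/
def srevStar (C : Finset (Finset ι)) (H : Finset ι → PMF ℝ≥0) : ℝ :=
  ⨆ p : ι → ℝ≥0, ∫ w, ∑ i : ι, (if Sold C w p i then (p i : ℝ) else 0) ∂(weightLaw H)

/-! ### Ironed virtual values and the benchmark term -/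

/-- The ironed revenue curve of `μ` at `q ∈ [0, 1]`: the least concave majorant on `[0, 1]` of the
revenue curve, i.e. of the points `(Pr[x ≥ p], p · Pr[x ≥ p])`, `p ≥ 0`. -/
def ironedRevenue (μ : PMF ℝ≥0) (q : ℝ) : ℝ :=
  sInf {y : ℝ | ∃ g : ℝ → ℝ, ConcaveOn ℝ (Icc 0 1) g ∧
    (∀ p : ℝ≥0, (p : ℝ) * μ.toMeasure.real (Ici p) ≤ g (μ.toMeasure.real (Ici p))) ∧ y = g q}

/-- Myerson's ironed virtual value of `μ` at a point `x` of its support: the slope of the ironed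
revenue curve between the quantiles `Pr[X > x]` and `Pr[X ≥ x]`, which differ by `Pr[X = x]`.
(With the revenue curve in place of the ironed one, this slope is
`x - (x' - x) · Pr[X > x] / Pr[X = x]`, where `x'` is the next larger point of the support.) -/
def ironedVirtualValue (μ : PMF ℝ≥0) (x : ℝ≥0) : ℝ :=
  (ironedRevenue μ (μ.toMeasure.real (Ici x)) - ironedRevenue μ (μ.toMeasure.real (Ioi x))) /
    (μ x).toReal

/-- The region `R_A`: the non-empty hyperedge `A` has the largest weight, ties being broken in
favour of the smaller `rank`. -/
def InRegion (rank : Finset ι → ℕ) (w : Finset ι → ℝ≥0) (A : Finset ι) : Prop :=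
  A.Nonempty ∧ ∀ T : Finset ι, T.Nonempty → T ≠ A →
    w T < w A ∨ (w T = w A ∧ rank A < rank T)

open Classical in
/-- The term `SINGLE` of the duality benchmark. -/
def single (H : Finset ι → PMF ℝ≥0) (rank : Finset ι → ℕ) : ℝ :=
  ∫ w, ∑ S : Finset ι,
    max 0 (ironedVirtualValue (H S) (w S)) * (if InRegion rank w S then 1 else 0) ∂(weightLaw H)

end Complements

end

namespace Complements

set_option linter.unusedSectionVars false

/-! ### Tails of a finitely supported distribution -/

section Tail

variable (μ : PMF ℝ≥0)

/-! Let `c = 4 * brev C H`. At most one region contains a given `w`, so the integrand of `single` is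
at most `c` plus the sum over non-empty `S` of the surplus of the ironed virtual value over `c`
(`sum_inRegion_le`). The expected surplus of `S` is at most the best profit `(p - c) * Pr[w S ≥ p]`
(`integral_ironedVirtualValue_sub_le`), attained, when positive, at a support point `r S`.

Only sets with `r S > c` contribute. The profile `r` itself lies in the support, so complementarity
bounds the degree of this family by `d`, and the family splits into `d` subfamilies in which every
set has a private item (`sum_le_of_degree_le`).

For one subfamily, put price `r S / 2` on the private item of each `S` and price `0` on all other
items. As `r S > 4 * brev C H`, the value without `w S` is below `r S / 2` with probability at least
one half, independently of `w S`. If also `w S ≥ r S`, every optimal bundle contains the private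
item. Half the price with half the probability gives the factor 4 of `sum_set_revenue_le`. -/

theorem ae_mem_support : ∀ᵐ x ∂μ.toMeasure, x ∈ μ.support := by
  rw [ae_iff]
  change μ.toMeasure μ.supportᶜ = 0
  rw [PMF.toMeasure_apply_eq_zero_iff _ μ.support_countable.measurableSet.compl]
  exact disjoint_compl_right

theorem tail_congr {s t : Set ℝ≥0} (hs : MeasurableSet s) (ht : MeasurableSet t)
    (h : ∀ x ∈ μ.support, x ∈ s ↔ x ∈ t) : μ.toMeasure.real s = μ.toMeasure.real t := by
  rw [measureReal_def, measureReal_def, PMF.toMeasure_apply_eq_of_inter_support_eq μ hs ht]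
  ext x
  constructor
  · rintro ⟨h1, h2⟩; exact ⟨(h x h2).1 h1, h2⟩
  · rintro ⟨h1, h2⟩; exact ⟨(h x h2).2 h1, h2⟩

theorem tail_mem_Icc (s : Set ℝ≥0) : μ.toMeasure.real s ∈ Icc (0 : ℝ) 1 :=
  ⟨measureReal_nonneg, measureReal_le_one⟩

theorem tail_Ici_eq (x : ℝ≥0) :
    μ.toMeasure.real (Ici x) = (μ x).toReal + μ.toMeasure.real (Ioi x) := by
  have h : Ici x = {x} ∪ Ioi x := by
    ext y; simp [le_iff_eq_or_lt]
  rw [h, measureReal_union (by simp) measurableSet_Ioi, measureReal_def,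
    PMF.toMeasure_apply_singleton _ _ (measurableSet_singleton x)]

theorem exists_tail_eq_zero (hfin : μ.support.Finite) :
    ∃ p : ℝ≥0, μ.toMeasure.real (Ici p) = 0 := by
  obtain ⟨b, hb⟩ := hfin.bddAbove
  refine ⟨b + 1, ?_⟩
  rw [tail_congr μ (t := ∅) measurableSet_Ici MeasurableSet.empty]
  · simp
  · intro x hx
    simp only [mem_Ici, mem_empty_iff_false, iff_false, not_le]
    exact lt_of_le_of_lt (hb hx) (by simp)

/-- Telescoping along the upper tail of the support. -/
theorem sum_tail_telescope (s : Finset ℝ≥0) (hs : μ.support = s) (F : ℝ → ℝ) (y : ℝ≥0) :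
    ∑ x ∈ s with y < x, (F (μ.toMeasure.real (Ici x)) - F (μ.toMeasure.real (Ioi x))) =
      F (μ.toMeasure.real (Ioi y)) - F 0 := by
  induction hn : (s.filter (fun x => y < x)).card using Nat.strong_induction_on generalizing y with
  | _ n ih =>
  have hmem : ∀ x, x ∈ μ.support ↔ x ∈ s := by intro x; rw [hs]; simp
  rcases (s.filter (fun x => y < x)).eq_empty_or_nonempty with he | hne
  · rw [he, tail_congr μ (s := Ioi y) (t := ∅) measurableSet_Ioi MeasurableSet.empty]
    · simp
    · intro x hx
      simp only [mem_Ioi, mem_empty_iff_false, iff_false]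
      intro hyx
      have : x ∈ s.filter (fun x => y < x) := Finset.mem_filter.2 ⟨(hmem x).1 hx, hyx⟩
      simp [he] at this
  · obtain ⟨m, hm, hmin⟩ := Finset.exists_min_image _ id hne
    simp only [Finset.mem_filter, id] at hm hmin
    have hsplit : s.filter (fun x => y < x) = insert m (s.filter (fun x => m < x)) := by
      ext x
      simp only [Finset.mem_filter, Finset.mem_insert]
      constructor
      · rintro ⟨h1, h2⟩
        rcases (hmin x ⟨h1, h2⟩).eq_or_lt with h | h
        · exact Or.inl h.symm
        · exact Or.inr ⟨h1, h⟩
      · rintro (rfl | ⟨h1, h2⟩)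
        · exact hm
        · exact ⟨h1, hm.2.trans h2⟩
    have hnot : m ∉ s.filter (fun x => m < x) := by simp
    have hcard : (s.filter (fun x => m < x)).card < n := by
      rw [← hn, hsplit, Finset.card_insert_of_notMem hnot]; omega
    -- `m` is the least support point above `y`, so there is no mass strictly between them.
    have htail : μ.toMeasure.real (Ioi y) = μ.toMeasure.real (Ici m) := by
      refine tail_congr μ measurableSet_Ioi measurableSet_Ici fun x hx => ⟨fun h => ?_, fun h => ?_⟩
      · exact hmin x ⟨(hmem x).1 hx, h⟩
      · exact hm.2.trans_le h
    rw [hsplit, Finset.sum_insert hnot, ih _ hcard m rfl, htail]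
    ring

end Tail

/-! ### The ironed revenue curve -/

section Ironing

variable (μ : PMF ℝ≥0)

/-- A concave function on `[0, 1]` that lies above the revenue curve of `μ`. -/
def IsMajorant (g : ℝ → ℝ) : Prop :=
  ConcaveOn ℝ (Icc 0 1) g ∧
    ∀ p : ℝ≥0, (p : ℝ) * μ.toMeasure.real (Ici p) ≤ g (μ.toMeasure.real (Ici p))

variable {μ}

/-- A price above the support and the price `0` put `(0, 0)` and `(1, 0)` on the revenue curve;
concavity does the rest. This bounds below the infimum defining `ironedRevenue`. -/
theorem IsMajorant.nonneg (hfin : μ.support.Finite) {g : ℝ → ℝ} (hg : IsMajorant μ g) {q : ℝ}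
    (hq : q ∈ Icc (0 : ℝ) 1) : 0 ≤ g q := by
  obtain ⟨p, hp⟩ := exists_tail_eq_zero μ hfin
  have h0 : 0 ≤ g 0 := by simpa [hp] using hg.2 p
  have h1 : 0 ≤ g 1 := by
    have h : (Ici (0 : ℝ≥0)) = univ := by ext; simp
    have := hg.2 0
    rw [h] at this
    simpa using this
  exact (le_min h0 h1).trans (hg.1.min_le_of_mem_Icc (by simp) (by simp) hq)

theorem IsMajorant.ironedRevenue_le (hfin : μ.support.Finite) {g : ℝ → ℝ} (hg : IsMajorant μ g)
    {q : ℝ} (hq : q ∈ Icc (0 : ℝ) 1) : ironedRevenue μ q ≤ g q := by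
  refine csInf_le ⟨0, ?_⟩ ⟨g, hg.1, hg.2, rfl⟩
  rintro y ⟨g', h1, h2, rfl⟩
  exact IsMajorant.nonneg hfin ⟨h1, h2⟩ hq

/-- The majorant `g₀` only ensures that the infimum is not over the empty set, where `sInf` would be
`0`. -/
theorem le_ironedRevenue {g₀ : ℝ → ℝ} (hg₀ : IsMajorant μ g₀) {q a : ℝ}
    (h : ∀ g, IsMajorant μ g → a ≤ g q) : a ≤ ironedRevenue μ q := by
  refine le_csInf ⟨_, g₀, hg₀.1, hg₀.2, rfl⟩ ?_
  rintro y ⟨g, h1, h2, rfl⟩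
  exact h g ⟨h1, h2⟩

theorem concaveOn_ironedRevenue (hfin : μ.support.Finite) {g₀ : ℝ → ℝ} (hg₀ : IsMajorant μ g₀) :
    ConcaveOn ℝ (Icc 0 1) (ironedRevenue μ) := by
  refine ⟨convex_Icc 0 1, fun x hx y hy a b ha hb hab => ?_⟩
  refine le_ironedRevenue hg₀ fun g hg => ?_
  refine le_trans ?_ (hg.1.2 hx hy ha hb hab)
  have h1 := hg.ironedRevenue_le hfin hx
  have h2 := hg.ironedRevenue_le hfin hy
  simp only [smul_eq_mul]
  gcongr

/-- An affine function of slope `c` lies above the revenue curve once its value at `0` exceeds the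
optimal revenue of a seller with cost `c`. -/
theorem isMajorant_affine {c K : ℝ}
    (hK : ∀ p : ℝ≥0, ((p : ℝ) - c) * μ.toMeasure.real (Ici p) ≤ K) :
    IsMajorant μ (fun q => K + c * q) := by
  refine ⟨?_, fun p => ?_⟩
  · refine ⟨convex_Icc 0 1, fun x _ y _ a b _ _ hab => le_of_eq ?_⟩
    simp only [smul_eq_mul]
    linear_combination K * hab
  · have := hK p
    linarith

/-- A concave function that increases from `a` to `b` is monotone to the left of `a`. -/
theorem ConcaveOn.le_of_lt_right {h : ℝ → ℝ} {s : Set ℝ} (hh : ConcaveOn ℝ s h) {x y a b : ℝ}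
    (hx : x ∈ s) (hy : y ∈ s) (hb : b ∈ s) (hxy : x ≤ y) (hya : y ≤ a) (hab : a ≤ b)
    (hlt : h a < h b) : h x ≤ h y := by
  by_contra! hcon
  have h1 := hh.min_le_of_mem_Icc hx hb ⟨hxy, hya.trans hab⟩
  have h2 := hh.min_le_of_mem_Icc hy hb ⟨hya, hab⟩
  rcases min_le_iff.1 h1 with h1 | h1 <;> rcases min_le_iff.1 h2 with h2 | h2 <;> linarith

theorem integral_eq_sum_support (s : Finset ℝ≥0) (hs : μ.support = s) (f : ℝ≥0 → ℝ) :
    ∫ x, f x ∂μ.toMeasure = ∑ x ∈ s, (μ x).toReal * f x := by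
  have hint : IntegrableOn f s μ.toMeasure := by
    rw [← Set.biUnion_of_singleton (s : Set ℝ≥0)]
    rw [integrableOn_finite_biUnion s.finite_toSet]
    intro x _
    exact integrableOn_singleton (by simp)
  have hr : μ.toMeasure.restrict s = μ.toMeasure := by
    rw [← hs]; exact PMF.restrict_toMeasure_support μ
  rw [IntegrableOn, hr] at hint
  rw [PMF.integral_eq_tsum μ f hint, tsum_eq_sum (s := s)]
  · simp
  · intro x hx
    have : x ∉ μ.support := by rw [hs]; simpa using hx
    rw [PMF.mem_support_iff, not_not] at this
    simp [this]

/-- The expected surplus of the ironed virtual value over `c` is at most the optimal revenue of a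
seller with cost `c`. -/
theorem integral_ironedVirtualValue_sub_le (hfin : μ.support.Finite) {c K : ℝ} (hK0 : 0 ≤ K)
    (hK : ∀ p : ℝ≥0, ((p : ℝ) - c) * μ.toMeasure.real (Ici p) ≤ K) :
    ∫ x, max 0 (ironedVirtualValue μ x - c) ∂μ.toMeasure ≤ K := by
  obtain ⟨s, hs⟩ := hfin.exists_finset_coe
  have hmaj := isMajorant_affine hK
  -- Tilting the curve by `c` turns `ironedVirtualValue μ x - c` into a slope of the concave
  -- function `h`, which satisfies `h ≤ K` and `h 0 ≥ 0`.
  set h : ℝ → ℝ := fun q => ironedRevenue μ q - c * q with hh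
  have hconc : ConcaveOn ℝ (Icc 0 1) h := by
    refine (concaveOn_ironedRevenue hfin hmaj).sub ⟨convex_Icc 0 1, fun x _ y _ a b _ _ _ => ?_⟩
    simp only [smul_eq_mul]
    exact le_of_eq (by ring)
  have hle : ∀ q ∈ Icc (0 : ℝ) 1, h q ≤ K := fun q hq => by
    have := hmaj.ironedRevenue_le hfin hq
    simp only [hh]; linarith
  have h0 : 0 ≤ h 0 := by
    have : 0 ≤ ironedRevenue μ 0 := le_ironedRevenue hmaj fun g hg => hg.nonneg hfin (by simp)
    simpa [hh] using this
  set D : ℝ≥0 → ℝ := fun x => h (μ.toMeasure.real (Ici x)) - h (μ.toMeasure.real (Ioi x)) with hD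
  have hpos : ∀ x ∈ s, 0 < (μ x).toReal := fun x hx => by
    have : x ∈ μ.support := by rw [← hs]; simpa using hx
    exact ENNReal.toReal_pos ((PMF.mem_support_iff _ _).1 this) (PMF.apply_ne_top _ _)
  have hterm : ∀ x ∈ s, (μ x).toReal * max 0 (ironedVirtualValue μ x - c) = max 0 (D x) := by
    intro x hx
    have hf := hpos x hx
    rw [mul_max_of_nonneg _ _ hf.le, mul_zero]
    congr 1
    simp only [hD, hh, ironedVirtualValue]
    rw [mul_sub, mul_div_cancel₀ _ hf.ne']
    have := tail_Ici_eq μ x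
    linear_combination c * this
  rw [integral_eq_sum_support s hs.symm, Finset.sum_congr rfl hterm]
  rcases (s.filter (fun x => 0 < D x)).eq_empty_or_nonempty with he | hne
  · rw [Finset.sum_eq_zero]
    · exact hK0
    · intro x hx
      refine max_eq_left (not_lt.1 fun hlt => ?_)
      have : x ∈ s.filter (fun x => 0 < D x) := Finset.mem_filter.2 ⟨hx, hlt⟩
      simp [he] at this
  -- Below `m` no increment is positive; above `m`, at smaller quantiles, concavity makes all of
  -- them non-negative. The positive parts therefore telescope to `h (Pr[X ≥ m]) - h 0 ≤ K`.
  obtain ⟨m, hm, hmin⟩ := Finset.exists_min_image _ id hne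
  simp only [Finset.mem_filter, id] at hm hmin
  have hDnn : ∀ x, m < x → 0 ≤ D x := by
    intro x hx
    have h1 : μ.toMeasure.real (Ioi x) ≤ μ.toMeasure.real (Ici x) :=
      measureReal_mono Ioi_subset_Ici_self
    have h2 : μ.toMeasure.real (Ici x) ≤ μ.toMeasure.real (Ioi m) :=
      measureReal_mono (Ici_subset_Ioi.2 hx)
    have h3 : μ.toMeasure.real (Ioi m) ≤ μ.toMeasure.real (Ici m) :=
      measureReal_mono Ioi_subset_Ici_self
    have h4 : h (μ.toMeasure.real (Ioi m)) < h (μ.toMeasure.real (Ici m)) := by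
      have := hm.2; simp only [hD] at this; linarith
    have := ConcaveOn.le_of_lt_right hconc (tail_mem_Icc μ _) (tail_mem_Icc μ _)
      (tail_mem_Icc μ _) h1 h2 h3 h4
    simp only [hD]; linarith
  have hsum : ∑ x ∈ s, max 0 (D x) = D m + ∑ x ∈ s with m < x, D x := by
    have hnot : m ∉ s.filter (fun x => m < x) := by simp
    rw [← Finset.sum_insert hnot]
    symm
    refine (Finset.sum_congr rfl fun x hx => ?_).trans (Finset.sum_subset ?_ fun x hx hx' => ?_)
    · rw [Finset.mem_insert, Finset.mem_filter] at hx
      rcases hx with rfl | hx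
      · exact (max_eq_right hm.2.le).symm
      · exact (max_eq_right (hDnn x hx.2)).symm
    · intro x hx
      rw [Finset.mem_insert, Finset.mem_filter] at hx
      rcases hx with rfl | hx
      · exact hm.1
      · exact hx.1
    · refine max_eq_left (not_lt.1 fun hlt => hx' ?_)
      rw [Finset.mem_insert, Finset.mem_filter]
      rcases (hmin x ⟨hx, hlt⟩).eq_or_lt with he | he
      · exact Or.inl he.symm
      · exact Or.inr ⟨hx, he⟩
  rw [hsum, sum_tail_telescope μ s hs.symm h m]
  have := hle _ (tail_mem_Icc μ (Ici m))
  simp only [hD]; linarith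

/-- The optimal revenue of a seller with cost `c` is attained at a point of the support. -/
theorem exists_optimal_price (hfin : μ.support.Finite) (c : ℝ) :
    ∃ r ∈ μ.support, ∀ p : ℝ≥0, ((p : ℝ) - c) * μ.toMeasure.real (Ici p) ≤
      max 0 (((r : ℝ) - c) * μ.toMeasure.real (Ici r)) := by
  obtain ⟨r, hr, hmax⟩ := Set.exists_max_image μ.support
    (fun p : ℝ≥0 => ((p : ℝ) - c) * μ.toMeasure.real (Ici p)) hfin μ.support_nonempty
  refine ⟨r, hr, fun p => ?_⟩
  rcases (μ.support ∩ Ici p).eq_empty_or_nonempty with he | hne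
  · rw [tail_congr μ (s := Ici p) (t := ∅) measurableSet_Ici MeasurableSet.empty]
    · simp
    · intro x hx
      simp only [mem_empty_iff_false, iff_false]
      exact fun h => (Set.eq_empty_iff_forall_notMem.1 he) x ⟨hx, h⟩
  -- Raising `p` to the next support point leaves the probability of sale unchanged.
  · obtain ⟨m, hm, hmin⟩ := Set.exists_min_image _ id (hfin.inter_of_left (Ici p)) hne
    have htail : μ.toMeasure.real (Ici p) = μ.toMeasure.real (Ici m) :=
      tail_congr μ measurableSet_Ici measurableSet_Ici fun x hx =>
        ⟨fun h => hmin x ⟨hx, h⟩, fun h => le_trans (mem_Ici.1 hm.2) (mem_Ici.1 h)⟩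
    have hpm : (p : ℝ) ≤ m := by exact_mod_cast hm.2
    refine le_max_of_le_right (le_trans ?_ (hmax m hm.1))
    simp only [htail]
    gcongr

end Ironing

variable {ι : Type*} [Fintype ι] [DecidableEq ι]

/-! ### Families of sets with private elements -/

/-- A minimal subfamily with the same union: each of its members has a private element. -/
theorem exists_cover_private (G : Finset (Finset ι)) :
    ∃ F ⊆ G, (∀ S ∈ G, ∀ i ∈ S, ∃ T ∈ F, i ∈ T) ∧
      ∀ S ∈ F, ∃ i ∈ S, ∀ T ∈ F, i ∈ T → T = S := by
  obtain ⟨F, ⟨hFG, hF⟩, hmin⟩ := exists_minimal_of_wellFoundedLT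
    (fun F : Finset (Finset ι) => F ⊆ G ∧ ∀ S ∈ G, ∀ i ∈ S, ∃ T ∈ F, i ∈ T)
    ⟨G, Finset.Subset.refl _, fun S hS i hi => ⟨S, hS, hi⟩⟩
  refine ⟨F, hFG, hF, fun S hS => ?_⟩
  -- Without a private element, `S` could be erased and the rest would still cover.
  by_contra! hcon
  have hle := hmin (y := F.erase S) ⟨(Finset.erase_subset _ _).trans hFG, fun A hA i hi => ?_⟩
    (Finset.erase_subset _ _)
  · exact Finset.notMem_erase S F (hle hS)
  · obtain ⟨T, hT, hiT⟩ := hF A hA i hi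
    by_cases hTS : T = S
    · subst hTS
      obtain ⟨T', h1, h2, h3⟩ := hcon i hiT
      exact ⟨T', Finset.mem_erase.2 ⟨h3, h1⟩, h2⟩
    · exact ⟨T, Finset.mem_erase.2 ⟨hTS, hT⟩, hiT⟩

/-- A family of non-empty sets of maximum degree `d` splits into `d` families whose members have
private elements. -/
theorem sum_le_of_degree_le (W : Finset ι → ℝ) (X : ℝ) (d : ℕ) (G : Finset (Finset ι))
    (hne : ∀ S ∈ G, S.Nonempty) (hdeg : ∀ i, (G.filter (fun S => i ∈ S)).card ≤ d)
    (hX : ∀ F ⊆ G, (∀ S ∈ F, ∃ i ∈ S, ∀ T ∈ F, i ∈ T → T = S) → ∑ S ∈ F, W S ≤ X) :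
    ∑ S ∈ G, W S ≤ d * X := by
  induction d generalizing G with
  | zero =>
    have : G = ∅ := by
      refine Finset.eq_empty_of_forall_notMem fun S hS => ?_
      obtain ⟨i, hi⟩ := hne S hS
      have h := Finset.card_eq_zero.1 (Nat.le_zero.1 (hdeg i))
      have : S ∈ G.filter (fun S => i ∈ S) := Finset.mem_filter.2 ⟨hS, hi⟩
      simp [h] at this
    simp [this]
  | succ d ih =>
    obtain ⟨F, hFG, hcov, hpriv⟩ := exists_cover_private G
    have hsub : G \ F ⊆ G := Finset.sdiff_subset
    have h1 := ih (G \ F) (fun S hS => hne S (hsub hS)) (fun i => ?_)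
      (fun F' hF' => hX F' (hF'.trans hsub))
    · have h2 := hX F hFG hpriv
      rw [← Finset.sum_sdiff hFG]
      push_cast
      linarith
    -- `F` covers every element that `G` covers, so removing it lowers each positive degree.
    · rcases ((G \ F).filter (fun S => i ∈ S)).eq_empty_or_nonempty with he | ⟨S, hS⟩
      · simp [he]
      · rw [Finset.mem_filter] at hS
        obtain ⟨T, hT, hiT⟩ := hcov S (hsub hS.1) i hS.2
        refine Nat.lt_succ_iff.1 (lt_of_lt_of_le (Finset.card_lt_card ?_) (hdeg i))
        refine (Finset.ssubset_iff_of_subset (Finset.filter_subset_filter _ hsub)).2 ⟨T, ?_, ?_⟩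
        · exact Finset.mem_filter.2 ⟨hFG hT, hiT⟩
        · simp [hT]

/-! ### The valuation -/

theorem value_mono_bundle (C : Finset (Finset ι)) (w : Finset ι → ℝ≥0) {A B : Finset ι}
    (h : A ⊆ B) : value C w A ≤ value C w B := by
  refine Finset.sup_mono fun T hT => ?_
  rw [Finset.mem_filter] at hT ⊢
  exact ⟨hT.1, hT.2.trans h⟩

theorem value_mono_weight (C : Finset (Finset ι)) {w w' : Finset ι → ℝ≥0} (h : w ≤ w')
    (A : Finset ι) : value C w A ≤ value C w' A :=
  Finset.sup_mono_fun fun _ _ => Finset.sum_le_sum fun U _ => h U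

theorem weight_le_value {C : Finset (Finset ι)} (w : Finset ι → ℝ≥0) {S : Finset ι} (hS : S ∈ C) :
    w S ≤ value C w S := by
  have h1 : ∑ U ∈ S.powerset, w U ≤ value C w S :=
    Finset.le_sup (f := fun T : Finset ι => ∑ U ∈ T.powerset, w U)
      (Finset.mem_filter.2 ⟨hS, Finset.Subset.refl S⟩)
  exact (Finset.single_le_sum (f := w) (fun _ _ => zero_le)
    (Finset.mem_powerset.2 (Finset.Subset.refl S))).trans h1

theorem value_update_of_not_subset (C : Finset (Finset ι)) (w : Finset ι → ℝ≥0) {S B : Finset ι}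
    (h : ¬ S ⊆ B) (x : ℝ≥0) : value C (Function.update w S x) B = value C w B := by
  refine Finset.sup_congr rfl fun T hT => Finset.sum_congr rfl fun U hU => ?_
  rw [Finset.mem_filter] at hT
  rw [Finset.mem_powerset] at hU
  refine Function.update_of_ne ?_ _ _
  rintro rfl
  exact h (hU.trans hT.2)

theorem measurable_value (C : Finset (Finset ι)) (A : Finset ι) :
    Measurable fun w : Finset ι → ℝ≥0 => value C w A := by
  unfold value
  induction C.filter (fun T => T ⊆ A) using Finset.induction_on with
  | empty => simpa only [Finset.sup_empty] using measurable_const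
  | insert T s _ ih =>
    simp only [Finset.sup_insert]
    exact (Finset.measurable_fun_sum _ fun U _ => measurable_pi_apply U).sup ih

/-- An item that is not wanted without `S` is sold if `S` is cheap enough. -/
theorem sold_of_value_lt {C : Finset (Finset ι)} {w : Finset ι → ℝ≥0} {p : ι → ℝ≥0}
    {S : Finset ι} (hS : S ∈ C) {i : ι} (hi : i ∈ S)
    (h : (value C (Function.update w S 0) Finset.univ : ℝ) < w S - ∑ j ∈ S, (p j : ℝ)) :
    Sold C w p i := by
  intro B hB
  by_contra hiB
  have hnot : ¬ S ⊆ B := fun hSB => hiB (hSB hi)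
  have h1 := hB S
  have h2 : (value C w B : ℝ) ≤ value C (Function.update w S 0) Finset.univ := by
    rw [← value_update_of_not_subset C w hnot 0]
    exact_mod_cast value_mono_bundle C _ (Finset.subset_univ B)
  have h3 : (w S : ℝ) ≤ value C w S := by exact_mod_cast weight_le_value w hS
  have h4 : 0 ≤ ∑ j ∈ B, (p j : ℝ) := Finset.sum_nonneg fun j _ => (p j).2
  unfold utility at h1
  linarith

open Classical in
/-- The buyer never pays more than the value of the grand bundle. -/
theorem sum_sold_le_value (C : Finset (Finset ι)) (w : Finset ι → ℝ≥0) (p : ι → ℝ≥0) :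
    ∑ i : ι, (if Sold C w p i then (p i : ℝ) else 0) ≤ value C w Finset.univ := by
  obtain ⟨S, -, hS⟩ := Finset.exists_max_image Finset.univ (utility C w p) Finset.univ_nonempty
  have hmax : ∀ S', utility C w p S' ≤ utility C w p S := fun S' => hS S' (Finset.mem_univ _)
  have h1 : ∑ i : ι, (if Sold C w p i then (p i : ℝ) else 0) ≤ ∑ i ∈ S, (p i : ℝ) := by
    rw [← Finset.sum_filter]
    refine Finset.sum_le_sum_of_subset_of_nonneg (fun i hi => ?_) fun i _ _ => (p i).2
    exact (Finset.mem_filter.1 hi).2 S hmax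
  have h2 := hmax ∅
  have h3 : (value C w S : ℝ) ≤ value C w Finset.univ := by
    exact_mod_cast value_mono_bundle C _ (Finset.subset_univ S)
  have h4 : (0 : ℝ) ≤ value C w ∅ := NNReal.coe_nonneg _
  simp only [utility, Finset.sum_empty] at h2
  linarith

/-! ### The law of the weights -/

section Law

variable (H : Finset ι → PMF ℝ≥0)

instance : IsProbabilityMeasure (weightLaw H) := by
  unfold weightLaw; infer_instance

theorem measurePreserving_eval_weightLaw (S : Finset ι) :
    MeasurePreserving (Function.eval S) (weightLaw H) (H S).toMeasure :=
  measurePreserving_eval (fun T => (H T).toMeasure) S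

theorem ae_weightLaw_mem_support : ∀ᵐ w ∂weightLaw H, ∀ T, w T ∈ (H T).support :=
  ae_all_iff.2 fun T =>
    (measurePreserving_eval_weightLaw H T).quasiMeasurePreserving.ae (ae_mem_support (H T))

variable {H}

theorem finite_support_pi (hfin : ∀ T, (H T).support.Finite) :
    {w : Finset ι → ℝ≥0 | ∀ T, w T ∈ (H T).support}.Finite := by
  have := Set.Finite.pi' hfin
  exact this

/-- The law is carried by a finite set, so no measurability of `f` is needed. -/
theorem integrable_weightLaw (hfin : ∀ T, (H T).support.Finite)
    (f : (Finset ι → ℝ≥0) → ℝ) : Integrable f (weightLaw H) := by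
  have hK := finite_support_pi hfin
  set K := {w : Finset ι → ℝ≥0 | ∀ T, w T ∈ (H T).support}
  have hr : (weightLaw H).restrict K = weightLaw H :=
    Measure.restrict_eq_self_of_ae_mem (ae_weightLaw_mem_support H)
  have : IntegrableOn f K (weightLaw H) := by
    rw [← Set.biUnion_of_singleton K, integrableOn_finite_biUnion hK]
    intro x _
    exact integrableOn_singleton (by simp)
  rwa [IntegrableOn, hr] at this

theorem integral_eval_weightLaw (hfin : ∀ T, (H T).support.Finite)
    (S : Finset ι) (f : ℝ≥0 → ℝ) :
    ∫ w, f (w S) ∂weightLaw H = ∫ x, f x ∂(H S).toMeasure := by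
  have hmp := measurePreserving_eval_weightLaw H S
  have hsm : AEStronglyMeasurable f (H S).toMeasure := by
    obtain ⟨s, hs⟩ := (hfin S).exists_finset_coe
    have hint : IntegrableOn f s (H S).toMeasure := by
      rw [← Set.biUnion_of_singleton (s : Set ℝ≥0), integrableOn_finite_biUnion s.finite_toSet]
      intro x _
      exact integrableOn_singleton (by simp)
    rw [IntegrableOn, hs, PMF.restrict_toMeasure_support] at hint
    exact hint.1
  rw [← hmp.map_eq] at hsm ⊢
  rw [integral_map hmp.measurable.aemeasurable hsm]

/-- Makes the suprema in `brev` and `srevStar` bounded, hence genuine upper bounds. -/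
theorem exists_value_bound (hfin : ∀ T, (H T).support.Finite)
    (C : Finset (Finset ι)) :
    ∃ V : ℝ≥0, ∀ᵐ w ∂weightLaw H, value C w Finset.univ ≤ V := by
  obtain ⟨V, hV⟩ := ((finite_support_pi hfin).image (fun w => value C w Finset.univ)).bddAbove
  refine ⟨V, ?_⟩
  filter_upwards [ae_weightLaw_mem_support H] with w hw
  exact hV ⟨w, hw, rfl⟩

theorem bundle_revenue_le_brev (hfin : ∀ T, (H T).support.Finite)
    (C : Finset (Finset ι)) (p : ℝ≥0) :
    (p : ℝ) * (weightLaw H).real {w | p ≤ value C w Finset.univ} ≤ brev C H := by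
  obtain ⟨V, hV⟩ := exists_value_bound hfin C
  refine le_ciSup (f := fun p : ℝ≥0 =>
    (p : ℝ) * (weightLaw H).real {w | p ≤ value C w Finset.univ}) ⟨V, ?_⟩ p
  rintro _ ⟨p, rfl⟩
  dsimp only
  rcases le_or_gt p V with h | h
  · have h1 : (weightLaw H).real {w | p ≤ value C w Finset.univ} ≤ 1 := measureReal_le_one
    have h2 : (p : ℝ) ≤ V := by exact_mod_cast h
    calc (p : ℝ) * _ ≤ p * 1 := by gcongr
      _ ≤ V := by simpa using h2
  · have : (weightLaw H) {w | p ≤ value C w Finset.univ} = 0 := by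
      rw [measure_eq_zero_iff_ae_notMem]
      filter_upwards [hV] with w hw hp
      exact absurd (le_trans (mem_ofPred.1 hp) hw) (not_le.2 h)
    simp [measureReal_def, this]

theorem brev_nonneg (hfin : ∀ T, (H T).support.Finite)
    (C : Finset (Finset ι)) : 0 ≤ brev C H := by
  simpa using bundle_revenue_le_brev hfin C 0

open Classical in
theorem item_revenue_le_srevStar (hfin : ∀ T, (H T).support.Finite)
    (C : Finset (Finset ι)) (p : ι → ℝ≥0) :
    ∫ w, ∑ i : ι, (if Sold C w p i then (p i : ℝ) else 0) ∂(weightLaw H) ≤ srevStar C H := by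
  obtain ⟨V, hV⟩ := exists_value_bound hfin C
  refine le_ciSup (f := fun p : ι → ℝ≥0 =>
    ∫ w, ∑ i : ι, (if Sold C w p i then (p i : ℝ) else 0) ∂(weightLaw H)) ⟨V, ?_⟩ p
  rintro _ ⟨p, rfl⟩
  dsimp only
  refine (integral_mono_ae (integrable_weightLaw hfin _)
    (integrable_weightLaw hfin (fun _ => (V : ℝ))) ?_).trans (by simp)
  filter_upwards [hV] with w hw
  exact (sum_sold_le_value C w p).trans (by exact_mod_cast hw)

end Law

/-- With the weight of `S` reset to `0`, the value depends only on the other coordinates, which are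
independent of `w S`. -/
theorem measureReal_inter_update_eq (H : Finset ι → PMF ℝ≥0) (C : Finset (Finset ι))
    (S : Finset ι) (r t : ℝ≥0) :
    (weightLaw H).real
      {w | r ≤ w S ∧ value C (Function.update w S 0) Finset.univ < t} =
    (H S).toMeasure.real (Ici r) *
      (weightLaw H).real {w | value C (Function.update w S 0) Finset.univ < t} := by
  have hind : ProbabilityTheory.iIndepFun (fun T (w : Finset ι → ℝ≥0) => w T) (weightLaw H) :=
    ProbabilityTheory.iIndepFun_pi (X := fun _ x => x) fun _ => aemeasurable_id
  have h2 := hind.indepFun_finset {S} ({S}ᶜ : Finset (Finset ι)) disjoint_compl_right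
    fun T => measurable_pi_apply T
  let f : (({S} : Finset (Finset ι)) → ℝ≥0) → ℝ≥0 := fun u => u ⟨S, by simp⟩
  let g : (({S}ᶜ : Finset (Finset ι)) → ℝ≥0) → ℝ≥0 := fun u =>
    value C (fun T => if h : T ∈ ({S}ᶜ : Finset (Finset ι)) then u ⟨T, h⟩ else 0) Finset.univ
  have hf : Measurable f := measurable_pi_apply _
  have hg : Measurable g := by
    refine (measurable_value C Finset.univ).comp (measurable_pi_lambda _ fun T => ?_)
    by_cases h : T ∈ ({S}ᶜ : Finset (Finset ι))
    · simpa only [h, dite_true] using measurable_pi_apply _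
    · simpa only [h, dite_false] using measurable_const
  have h3 := h2.comp hf hg
  have hgw : ∀ w : Finset ι → ℝ≥0, g (fun T => w T) =
      value C (Function.update w S 0) Finset.univ := by
    intro w
    simp only [g]
    congr 1
    funext T
    by_cases h : T = S
    · subst h; simp
    · simp [h]
  have h4 := h3.measure_inter_preimage_eq_mul (Ici r) (Iio t) measurableSet_Ici measurableSet_Iio
  have e1 : (f ∘ fun (w : Finset ι → ℝ≥0) (i : ({S} : Finset (Finset ι))) => w i) ⁻¹' Ici r =
      Function.eval S ⁻¹' Ici r := rfl
  have e2 : (g ∘ fun (w : Finset ι → ℝ≥0) (i : ({S}ᶜ : Finset (Finset ι))) => w i) ⁻¹' Iio t =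
      {w | value C (Function.update w S 0) Finset.univ < t} := by
    ext w
    simp only [mem_preimage, Function.comp, hgw, mem_Iio, mem_ofPred_eq]
  rw [e1, e2, (measurePreserving_eval_weightLaw H S).measure_preimage
    measurableSet_Ici.nullMeasurableSet] at h4
  simp only [measureReal_def]
  rw [← ENNReal.toReal_mul, ← h4]
  rfl

/-! ### Selling sets through their private items -/

section Selling

variable {H : Finset ι → PMF ℝ≥0}

/-- Above the price `4 · BREV`, a set is the buyer's dominant interest with conditional probability
at least one half. -/
theorem tail_le_two_mul_measureReal (hfin : ∀ T, (H T).support.Finite)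
    (C : Finset (Finset ι)) (S : Finset ι) {r : ℝ≥0}
    (hr : 4 * brev C H < r) :
    (H S).toMeasure.real (Ici r) ≤ 2 * (weightLaw H).real
      {w | r ≤ w S ∧ value C (Function.update w S 0) Finset.univ < r / 2} := by
  rw [measureReal_inter_update_eq]
  have hb := brev_nonneg hfin C
  have hrev := bundle_revenue_le_brev hfin C (r / 2)
  have hmeas : MeasurableSet {w : Finset ι → ℝ≥0 | r / 2 ≤ value C w Finset.univ} :=
    measurableSet_le measurable_const (measurable_value C Finset.univ)
  have hcompl : 1 - (weightLaw H).real {w | r / 2 ≤ value C w Finset.univ} ≤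
      (weightLaw H).real {w | value C (Function.update w S 0) Finset.univ < r / 2} := by
    rw [← probReal_compl_eq_one_sub hmeas]
    refine measureReal_mono fun w hw => ?_
    refine lt_of_le_of_lt (value_mono_weight C ?_ _) (not_le.1 hw)
    exact update_le_self_iff.2 zero_le
  have hhalf : (weightLaw H).real {w | r / 2 ≤ value C w Finset.univ} ≤ 1 / 2 := by
    -- Otherwise the bundle price `r / 2` would earn more than `r / 4 > brev C H`.
    by_contra! hcon
    push_cast at hrev
    have hr0 : (0 : ℝ) < r := by linarith
    nlinarith
  have hq : 0 ≤ (H S).toMeasure.real (Ici r) := measureReal_nonneg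
  nlinarith

/-- Item prices on private items extract a quarter of the revenue of separate set prices. -/
theorem sum_set_revenue_le (hfin : ∀ T, (H T).support.Finite)
    (C : Finset (Finset ι)) (r : Finset ι → ℝ≥0) (F : Finset (Finset ι))
    (hFC : F ⊆ C) (hr : ∀ S ∈ F, 4 * brev C H < r S)
    (hpriv : ∀ S ∈ F, ∃ i ∈ S, ∀ T ∈ F, i ∈ T → T = S) :
    ∑ S ∈ F, (r S : ℝ) * (H S).toMeasure.real (Ici (r S)) ≤ 4 * srevStar C H := by
  classical
  -- `choose!` below needs a default item.
  rcases isEmpty_or_nonempty ι with hι | hι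
  · have hF : F = ∅ := by
      refine Finset.eq_empty_of_forall_notMem fun S hS => ?_
      obtain ⟨i, -⟩ := hpriv S hS
      exact hι.elim i
    have := item_revenue_le_srevStar hfin C (fun i => 0)
    simp only [NNReal.coe_zero, ite_self, Finset.sum_const_zero, integral_zero] at this
    simpa [hF] using this
  choose! π hπ hπ' using hpriv
  let p : ι → ℝ≥0 := fun i => ∑ T ∈ F, if π T = i then r T / 2 else 0
  have hprice : ∀ S ∈ F, ∑ j ∈ S, (p j : ℝ) = r S / 2 := by
    intro S hS
    simp only [p, NNReal.coe_sum]
    rw [Finset.sum_comm, Finset.sum_eq_single_of_mem S hS]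
    · rw [Finset.sum_eq_single_of_mem (π S) (hπ S hS)]
      · simp
      · intro j _ hj; simp [hj.symm]
    -- The private item of another member `T` is not in `S`, so it adds nothing to the cost of `S`.
    · intro T hT hTS
      refine Finset.sum_eq_zero fun j hj => ?_
      rw [if_neg, NNReal.coe_zero]
      rintro rfl
      exact hTS (hπ' T hT S hS hj).symm
  let E : Finset ι → Set (Finset ι → ℝ≥0) := fun S =>
    {w | r S ≤ w S ∧ value C (Function.update w S 0) Finset.univ < r S / 2}
  have hE : ∀ S, MeasurableSet (E S) := fun S => by
    have hv : Measurable fun w : Finset ι → ℝ≥0 =>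
        value C (Function.update w S 0) Finset.univ := by
      refine (measurable_value C Finset.univ).comp (measurable_pi_lambda _ fun T => ?_)
      by_cases h : T = S
      · subst h
        simp only [Function.update_self]
        exact measurable_const
      · simp only [Function.update_of_ne h]
        exact measurable_pi_apply T
    have h1 : MeasurableSet {w : Finset ι → ℝ≥0 | r S ≤ w S} :=
      measurableSet_le measurable_const (measurable_pi_apply S)
    have h2 : MeasurableSet {w : Finset ι → ℝ≥0 |
        value C (Function.update w S 0) Finset.univ < r S / 2} :=
      measurableSet_lt hv measurable_const
    exact h1.inter h2
  have hsold : ∀ S ∈ F, ∀ w ∈ E S, Sold C w p (π S) := by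
    intro S hS w hw
    refine sold_of_value_lt (hFC hS) (hπ S hS) ?_
    rw [hprice S hS]
    have h1 : (r S : ℝ) ≤ w S := by exact_mod_cast hw.1
    have h2 : (value C (Function.update w S 0) Finset.univ : ℝ) < r S / 2 := by
      exact_mod_cast hw.2
    linarith
  have hpoint : ∀ w, ∑ S ∈ F, (E S).indicator (fun _ => (r S : ℝ) / 2) w ≤
      ∑ i : ι, (if Sold C w p i then (p i : ℝ) else 0) := by
    intro w
    have : ∑ i : ι, (if Sold C w p i then (p i : ℝ) else 0) =
        ∑ S ∈ F, if Sold C w p (π S) then (r S : ℝ) / 2 else 0 := by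
      have : ∀ i, (if Sold C w p i then (p i : ℝ) else 0) =
          ∑ S ∈ F, if π S = i then (if Sold C w p i then (r S : ℝ) / 2 else 0) else 0 := by
        intro i
        split_ifs with h
        · simp only [p, NNReal.coe_sum]
          refine Finset.sum_congr rfl fun S _ => ?_
          split_ifs <;> simp
        · simp
      simp only [this]
      rw [Finset.sum_comm]
      simp
    rw [this]
    refine Finset.sum_le_sum fun S hS => ?_
    by_cases hw : w ∈ E S
    · rw [indicator_of_mem hw, if_pos (hsold S hS w hw)]
    · rw [indicator_of_notMem hw]
      split_ifs <;> positivity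
  have hint := (integral_mono (integrable_weightLaw hfin _) (integrable_weightLaw hfin _)
    hpoint).trans (item_revenue_le_srevStar hfin C p)
  rw [integral_finsetSum _ fun S _ => integrable_weightLaw hfin _] at hint
  have hsum : ∑ S ∈ F, (r S : ℝ) * (H S).toMeasure.real (Ici (r S)) ≤
      4 * ∑ S ∈ F, ∫ w, (E S).indicator (fun _ => (r S : ℝ) / 2) w ∂weightLaw H := by
    rw [Finset.mul_sum]
    refine Finset.sum_le_sum fun S hS => ?_
    rw [integral_indicator_const _ (hE S), smul_eq_mul]
    have := mul_le_mul_of_nonneg_left (tail_le_two_mul_measureReal hfin C S (hr S hS)) (r S).2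
    simp only [NNReal.val_eq_coe] at this
    refine this.trans (le_of_eq ?_)
    simp only [E]
    ring
  linarith

end Selling

/-! ### The benchmark term -/

theorem InRegion.unique {rank : Finset ι → ℕ} {w : Finset ι → ℝ≥0} {A B : Finset ι}
    (hA : InRegion rank w A) (hB : InRegion rank w B) : A = B := by
  by_contra hne
  rcases hA.2 B hB.1 (Ne.symm hne) with h | ⟨h, h'⟩ <;>
    rcases hB.2 A hA.1 hne with k | ⟨k, k'⟩
  · exact lt_asymm h k
  · exact h.ne' k
  · exact k.ne' h
  · exact lt_asymm h' k'

-- At most one summand on the left is non-zero, so `c` is paid once and not once per set.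
open Classical in
theorem sum_inRegion_le (rank : Finset ι → ℕ) (w : Finset ι → ℝ≥0) (φ : Finset ι → ℝ) {c : ℝ}
    (hc : 0 ≤ c) :
    ∑ S : Finset ι, max 0 (φ S) * (if InRegion rank w S then 1 else 0) ≤
      c + ∑ S with S.Nonempty, max 0 (φ S - c) := by
  have hnn : ∀ S ∈ Finset.univ.filter (fun S : Finset ι => S.Nonempty), 0 ≤ max 0 (φ S - c) :=
    fun S _ => le_max_left _ _
  by_cases h : ∃ A, InRegion rank w A
  · obtain ⟨A, hA⟩ := h
    rw [Finset.sum_eq_single_of_mem A (Finset.mem_univ A)]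
    · have h1 := Finset.single_le_sum hnn (Finset.mem_filter.2 ⟨Finset.mem_univ A, hA.1⟩)
      have h2 : max 0 (φ A) ≤ c + max 0 (φ A - c) := by
        refine max_le ?_ ?_
        · linarith [le_max_left 0 (φ A - c)]
        · linarith [le_max_right 0 (φ A - c)]
      simp only [hA, if_true, mul_one]
      linarith
    · intro B _ hBA
      rw [if_neg fun hB => hBA (hB.unique hA), mul_zero]
  · push Not at h
    simp only [h, if_false, mul_zero, Finset.sum_const_zero]
    linarith [Finset.sum_nonneg hnn]

/-- Complementarity bounds the degree of the hypergraph of sets with a positive support point. -/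
theorem HasComplementarity.degree_le {H : Finset ι → PMF ℝ≥0} {d : ℕ}
    (hd : HasComplementarity H d) {r : Finset ι → ℝ≥0} (hr : ∀ S, r S ∈ (H S).support)
    (G : Finset (Finset ι)) (hG : ∀ S ∈ G, 0 < r S) (i : ι) :
    (G.filter (fun S => i ∈ S)).card ≤ d := by
  refine (Finset.card_le_card fun S hS => ?_).trans (hd r hr i)
  rw [Finset.mem_filter] at hS
  exact Finset.mem_filter.2 ⟨Finset.mem_univ _, hS.2, hG S hS.1⟩

end Complements

theorem proposition4p1 {ι : Type*} [Fintype ι] [DecidableEq ι]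
    (C : Finset (Finset ι)) (hC : IsLowerSet (C : Set (Finset ι)))
    (H : Finset ι → PMF ℝ≥0)
    (hfin : ∀ T, (H T).support.Finite)
    (hempty : H ∅ = PMF.pure 0)
    (hfeas : ∀ T, T ∉ C → H T = PMF.pure 0)
    (d : ℕ) (hd : Complements.HasComplementarity H d)
    (rank : Finset ι → ℕ) (hrank : Function.Injective rank) :
    Complements.single H rank ≤
      4 * (d : ℝ) * Complements.srevStar C H + 4 * Complements.brev C H := by
  classical
  open Complements in
  set c : ℝ := 4 * brev C H with hc
  have hc0 : 0 ≤ c := mul_nonneg (by norm_num) (brev_nonneg hfin C)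
  choose r hr hopt using fun S => exists_optimal_price (hfin S) c
  set q : Finset ι → ℝ := fun S => (H S).toMeasure.real (Ici (r S)) with hq
  have hq0 : ∀ S, 0 ≤ q S := fun S => measureReal_nonneg
  set G := Finset.univ.filter (fun S : Finset ι => S.Nonempty ∧ c < r S) with hG
  have hGmem : ∀ S ∈ G, S.Nonempty ∧ c < r S := fun S hS => (Finset.mem_filter.1 hS).2
  have hGpos : ∀ S ∈ G, 0 < r S := fun S hS => by
    have : (0 : ℝ) < r S := hc0.trans_lt (hGmem S hS).2
    exact_mod_cast this
  -- An infeasible set has support `{0}`, which would force `r S = 0`.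
  have hGC : G ⊆ C := fun S hS => by
    by_contra hSC
    have h := hr S
    rw [hfeas S hSC] at h
    simp only [PMF.support_pure, mem_singleton_iff] at h
    exact (hGpos S hS).ne' h
  have hbound : single H rank ≤ c + ∑ S with S.Nonempty, max 0 (((r S : ℝ) - c) * q S) := by
    calc single H rank
        ≤ ∫ w, (c + ∑ S with S.Nonempty, max 0 (ironedVirtualValue (H S) (w S) - c))
            ∂weightLaw H := by
          refine integral_mono (integrable_weightLaw hfin _) (integrable_weightLaw hfin _) ?_
          intro w
          exact sum_inRegion_le rank w (fun S => ironedVirtualValue (H S) (w S)) hc0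
      _ = c + ∑ S with S.Nonempty,
            ∫ w, max 0 (ironedVirtualValue (H S) (w S) - c) ∂weightLaw H := by
          rw [integral_add (integrable_weightLaw hfin _) (integrable_weightLaw hfin _),
            integral_finsetSum _ fun S _ => integrable_weightLaw hfin _]
          simp
      _ ≤ _ := by
          gcongr with S _
          rw [integral_eval_weightLaw hfin S (fun x => max 0 (ironedVirtualValue (H S) x - c))]
          exact integral_ironedVirtualValue_sub_le (hfin S) (le_max_left _ _) (hopt S)
  have hsum : ∑ S with S.Nonempty, max 0 (((r S : ℝ) - c) * q S) ≤ ∑ S ∈ G, (r S : ℝ) * q S := by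
    have hsub : G ⊆ Finset.univ.filter (fun S : Finset ι => S.Nonempty) := fun S hS =>
      Finset.mem_filter.2 ⟨Finset.mem_univ _, (hGmem S hS).1⟩
    rw [← Finset.sum_subset hsub]
    · refine Finset.sum_le_sum fun S _ => max_le (mul_nonneg (r S).2 (hq0 S)) ?_
      exact mul_le_mul_of_nonneg_right (by linarith) (hq0 S)
    -- A best price of at most `c` leaves no profit over the cost `c`.
    · intro S hS hSG
      have hle : (r S : ℝ) ≤ c := not_lt.1 fun h =>
        hSG (Finset.mem_filter.2 ⟨Finset.mem_univ _, (Finset.mem_filter.1 hS).2, h⟩)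
      exact max_eq_left (mul_nonpos_of_nonpos_of_nonneg (by linarith) (hq0 S))
  have hdecomp := sum_le_of_degree_le (fun S => (r S : ℝ) * q S) (4 * srevStar C H) d G
    (fun S hS => (hGmem S hS).1) (hd.degree_le hr G hGpos) fun F hF hpriv =>
      sum_set_revenue_le hfin C r F (hF.trans hGC) (fun S hS => (hGmem S (hF hS)).2) hpriv
  linarith
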